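/- Let $b_1,\dots,b_n$ be a basis of $\mathbb{R}^n$, let $\mathcal{L}=\{\sum_j c_j b_j : c_j\in\mathbb{Z}\}$ be the full-rank lattice it generates, and let $b_1^*,\dots,b_n^*$ be its Gram–Schmidt orthogonalization (without normalization). A linearly independent family $d_1,\dots,d_n$ is called *HKZ-reduced* if, with $d_j^*$ its Gram–Schmidt vectors, $\langle d_i,d_j^*\rangle/\langle d_j^*,d_j^*\rangle\le \tfrac12$ for all $j<i$ (in particular this allows the usual condition $|\langle d_i,d_j^*\rangle|/\langle d_j^*,d_j^*\rangle\le\tfrac12$), and for every $i$ the norm $\|d_i^*\|$ is the smallest norm of a nonzero vector of $\pi_i(\mathcal{L}(d_1,\dots,d_n))$, where $\mathcal{L}(d_1,\dots,d_n)$ is the set of integer linear combinations of $d_1,\dots,d_n$ and $\pi_i$ is the orthogonal projection onto $\mathrm{span}(d_1,\dots,d_{i-1})^{\perp}$. The basis $b_1,\dots,b_n$ is called *dual HKZ-reduced* if its reverse dual basis $b_1^\times,\dots,b_n^\times$, determined by $\langle b_i^\times,b_j\rangle=1$ if $i=n-j+1$ and $0$ otherwise, is HKZ-reduced. Assume that $b_1,\dots,b_n$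 is dual HKZ-reduced. Let $t\in\mathbb{R}^n$, let $v\in\mathcal{L}$ be a closest lattice vector to $t$ in the Euclidean norm, and write the error vector as $t-v=e_1b_1^*+\dots+e_nb_n^*$ with $e_j\in\mathbb{R}$. Then for every $i=2,\dots,n$, $$e_{i-1}^2\left(\frac{i^2}{4}-\frac14\right)+e_i^2\,\frac{(i-1)^2}{4}\;\le\;\frac{i^2}{4}\cdot\frac{(i-1)^2}{4}.$$ Thus the pair $(e_{i-1},e_i)$, which lies in the rectangle given by $|e_{i-1}|\le\frac{i-1}{2}$ and $|e_i|\le\frac i2$ (with side lengths $i-1$ and $i$), also lies in the ellipse given by this inequality. -/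

import Mathlib

noncomputable section

/-- The lattice `𝓛(b₁, …, b_k)`: all integer linear combinations of the vectors `b₁, …, b_k`. -/
def latticeOf {n k : ℕ} (b : Fin k → EuclideanSpace ℝ (Fin n)) :
    Submodule ℤ (EuclideanSpace ℝ (Fin n)) :=
  Submodule.span ℤ (Set.range b)

/-- The first minimum `λ₁(S)`: the smallest norm of a nonzero element of `S`. For a lattice of
positive rank the infimum is attained. -/
def firstMinimum {n : ℕ} (S : Set (EuclideanSpace ℝ (Fin n))) : ℝ :=
  sInf {r : ℝ | ∃ v ∈ S, v ≠ 0 ∧ r = ‖v‖}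

/-- The projected lattice `π_i(𝓛(b))`, where `π_i` is the orthogonal projection onto the
orthogonal complement of the span of the vectors `b_j` with `j < i`. -/
def projectedLattice {n k : ℕ} (b : Fin k → EuclideanSpace ℝ (Fin n)) (i : Fin k) :
    Set (EuclideanSpace ℝ (Fin n)) :=
  (fun v => (Submodule.span ℝ (b '' Set.Iio i))ᗮ.starProjection v) ''
    (latticeOf b : Set (EuclideanSpace ℝ (Fin n)))

/-- `b` is an HKZ basis of the lattice it generates. The size-reduction condition is one-sided;
it is implied by the common variant with an absolute value. -/
structure IsHKZ {n k : ℕ} (b : Fin k → EuclideanSpace ℝ (Fin n)) : Prop where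
  linearIndependent : LinearIndependent ℝ b
  size_reduced : ∀ i j : Fin k, j < i →
    inner ℝ (b i) (InnerProductSpace.gramSchmidt ℝ b j) /
      inner ℝ (InnerProductSpace.gramSchmidt ℝ b j) (InnerProductSpace.gramSchmidt ℝ b j) ≤ 1 / 2
  norm_gramSchmidt : ∀ i : Fin k,
    ‖InnerProductSpace.gramSchmidt ℝ b i‖ = firstMinimum (projectedLattice b i)

/-- `d` is the reverse dual basis of `b`: with indices from `1` to `k`, each `d_i` lies in the span
of `b`, and `⟪d_i, b_j⟫` is `1` if `i = k - j + 1` and `0` otherwise. -/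
def IsReverseDual {n k : ℕ} (b d : Fin k → EuclideanSpace ℝ (Fin n)) : Prop :=
  (∀ i, d i ∈ Submodule.span ℝ (Set.range b)) ∧
    ∀ i j, inner ℝ (d i) (b j) = if i = Fin.rev j then (1 : ℝ) else 0

/-- `b` is a dual HKZ basis: it is linearly independent and its (unique) reverse dual basis is
HKZ reduced. -/
def IsDualHKZ {n k : ℕ} (b : Fin k → EuclideanSpace ℝ (Fin n)) : Prop :=
  LinearIndependent ℝ b ∧ ∃ d : Fin k → EuclideanSpace ℝ (Fin n), IsReverseDual b d ∧ IsHKZ d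

/-- `v` is a closest vector to `t` in the lattice `L`. -/
def IsClosestVector {n : ℕ} (L : Submodule ℤ (EuclideanSpace ℝ (Fin n)))
    (t v : EuclideanSpace ℝ (Fin n)) : Prop :=
  v ∈ L ∧ ∀ w ∈ L, ‖v - t‖ ≤ ‖w - t‖

end

/-! Let `L_q` be the lattice generated by the first `q` basis vectors. Its dual is the lattice of
the reverse dual basis, projected orthogonally to the vectors preceding the one paired with `b_q`.
HKZ reduction makes the first Gram–Schmidt vector of that projection a shortest one, and its norm is
at least `1 / ‖b_q*‖`. Banaszczyk's transference bound `exists_norm_le_of_dual_minimum` then gives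
`L_q` covering radius at most `(q / 2) ‖b_q*‖` (`IsDualHKZ.exists_norm_sub_le`).

The truncation of `t - v` to its first `q` coordinates is a shortest element of its coset modulo
`L_q` (`IsClosestVector.norm_sum_Iic_le`), so its norm is at most that radius. Taking `q = i` and `q
= i - 1` gives two inequalities. A third comes from rounding `e_i` to within `1 / 2` and then
covering with `L_{i-1}`. Eliminating the unknown ratio of `‖b_{i-1}*‖` to `‖b_i*‖` gives the ellipse
(`ellipse_of_bounds`).

Transference rests on Poisson summation for Gaussians, `exists_gaussianSum_eq_dual`, proved by
induction on the rank from the one-dimensional case. -/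

/-! ### Gaussian sums over lattices: summability and the rank-one Poisson formula. -/

section GaussianSums

open Real Complex

variable {V : Type*} [NormedAddCommGroup V] [InnerProductSpace ℝ V]

/-- The summand of a lattice Gaussian sum with translation `u` and phase `z`. -/
noncomputable def gaussianTerm {n : ℕ} (s : ℝ) (b : Fin n → V) (u z : Fin n → ℝ) (x : Fin n → ℤ) : ℂ :=
  cexp (((-π * s * ‖∑ j, ((x j : ℝ) + u j) • b j‖ ^ 2 : ℝ) : ℂ)
    + ((2 * π * ∑ j, z j * ((x j : ℝ) + u j) : ℝ) : ℂ) * I)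

/-- The lattice Gaussian sum with translation `u` and phase `z`. -/
noncomputable def gaussianSum {n : ℕ} (s : ℝ) (b : Fin n → V) (u z : Fin n → ℝ) : ℂ :=
  ∑' x : Fin n → ℤ, gaussianTerm s b u z x

theorem norm_gaussianTerm {n : ℕ} (s : ℝ) (b : Fin n → V) (u z : Fin n → ℝ) (x : Fin n → ℤ) :
    ‖gaussianTerm s b u z x‖ = rexp (-π * s * ‖∑ j, ((x j : ℝ) + u j) • b j‖ ^ 2) := by
  rw [gaussianTerm, Complex.exp_add, norm_mul, Complex.norm_exp_ofReal_mul_I, mul_one,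
    ← Complex.ofReal_exp, Complex.norm_real, Real.norm_eq_abs, abs_of_pos (Real.exp_pos _)]

theorem summable_gaussian_int {a : ℝ} (ha : 0 < a) (v : ℝ) :
    Summable fun x : ℤ => rexp (-π * a * ((x : ℝ) + v) ^ 2) := by
  have h := (summable_jacobiTheta₂_term_iff ((a * v : ℝ) * I) ((a : ℝ) * I)).2 (by simpa using ha)
  have h2 := (h.norm).mul_left (rexp (-π * a * v ^ 2))
  refine h2.congr fun x => ?_
  rw [norm_jacobiTheta₂_term, ← Real.exp_add]
  congr 1
  simp
  ring

/-- Expanding both squares, the two series differ by one common factor from those of the functional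
equation of the Jacobi theta function. -/
theorem tsum_gaussian_int {a : ℝ} (ha : 0 < a) (v z : ℝ) :
    ∑' x : ℤ, cexp (((-π * a * ((x : ℝ) + v) ^ 2 : ℝ) : ℂ)
        + ((2 * π * (z * ((x : ℝ) + v)) : ℝ) : ℂ) * I) =
      ((a ^ (-(1 / 2) : ℝ) : ℝ) : ℂ) * ∑' y : ℤ, cexp (((-π * a⁻¹ * ((y : ℝ) - z) ^ 2 : ℝ) : ℂ)
        + ((2 * π * (y * v) : ℝ) : ℂ) * I) := by
  have key := Complex.tsum_exp_neg_quadratic (a := (a : ℂ)) (by simpa using ha) (-a * v + I * z)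
  have ha' : (a : ℂ) ≠ 0 := by exact_mod_cast ha.ne'
  have e1 : ∀ x : ℤ, cexp (((-π * a * ((x : ℝ) + v) ^ 2 : ℝ) : ℂ)
        + ((2 * π * (z * ((x : ℝ) + v)) : ℝ) : ℂ) * I) =
      cexp (-π * a * v ^ 2 + 2 * π * I * z * v) *
        cexp (-π * a * (x : ℂ) ^ 2 + 2 * π * (-a * v + I * z) * x) := by
    intro x
    rw [← Complex.exp_add]
    congr 1
    push_cast
    ring
  have e2 : ∀ y : ℤ, cexp (((-π * a⁻¹ * ((y : ℝ) - z) ^ 2 : ℝ) : ℂ)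
        + ((2 * π * (y * v) : ℝ) : ℂ) * I) =
      cexp (-π * a * v ^ 2 + 2 * π * I * z * v) *
        cexp (-π / a * ((y : ℂ) + I * (-a * v + I * z)) ^ 2) := by
    intro y
    rw [← Complex.exp_add]
    congr 1
    push_cast
    have hI : I ^ 2 = -1 := I_sq
    have h3 : (y : ℂ) + I * (-a * v + I * z) = (y - z) - a * (I * v) := by
      linear_combination z * hI
    rw [h3]
    field_simp
    linear_combination (a ^ 2 * v ^ 2 : ℂ) * hI
  simp_rw [e1, e2]
  rw [tsum_mul_left, tsum_mul_left, key]
  have h4 : ((a ^ (-(1 / 2) : ℝ) : ℝ) : ℂ) = 1 / (a : ℂ) ^ (1 / 2 : ℂ) := by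
    rw [Real.rpow_neg ha.le, Complex.ofReal_inv, Complex.ofReal_cpow ha.le]
    simp
  rw [h4]
  ring

theorem summable_gaussian_pi {a : ℝ} (ha : 0 < a) : ∀ {n : ℕ} (u : Fin n → ℝ),
    Summable fun x : Fin n → ℤ => rexp (-π * a * ∑ j, ((x j : ℝ) + u j) ^ 2)
  | 0, _ => Summable.of_finite
  | n + 1, u => by
    rw [← (Fin.consEquiv fun _ : Fin (n + 1) => ℤ).summable_iff]
    refine ((summable_gaussian_int ha (u 0)).mul_of_nonneg
      (summable_gaussian_pi ha (fun j => u j.succ))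
      (fun _ => (Real.exp_pos _).le) (fun _ => (Real.exp_pos _).le)).congr fun p => ?_
    simp only [Function.comp, Fin.consEquiv, Equiv.coe_fn_mk, Fin.sum_univ_succ, Fin.cons_zero,
      Fin.cons_succ, ← Real.exp_add]
    congr 1
    ring

/-- Pairing with `d j` recovers the `j`-th coordinate; Cauchy–Schwarz does the rest. This makes
lattice Gaussians comparable with product Gaussians. -/
theorem sum_sq_le_of_biorthogonal {n : ℕ} {b d : Fin n → V}
    (h : ∀ i j, inner ℝ (d i) (b j) = if i = j then (1 : ℝ) else 0) (c : Fin n → ℝ) :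
    ∑ j, c j ^ 2 ≤ (∑ j, ‖d j‖ ^ 2) * ‖∑ j, c j • b j‖ ^ 2 := by
  rw [Finset.sum_mul]
  refine Finset.sum_le_sum fun j _ => ?_
  have h1 : inner ℝ (d j) (∑ k, c k • b k) = c j := by
    simp [inner_sum, inner_smul_right, h]
  have h2 := abs_real_inner_le_norm (d j) (∑ k, c k • b k)
  rw [h1] at h2
  rw [← mul_pow, ← sq_abs (c j)]
  gcongr

theorem summable_gaussian {n : ℕ} {b d : Fin n → V}
    (h : ∀ i j, inner ℝ (d i) (b j) = if i = j then (1 : ℝ) else 0) {s : ℝ} (hs : 0 < s)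
    (u : Fin n → ℝ) :
    Summable fun x : Fin n → ℤ => rexp (-π * s * ‖∑ j, ((x j : ℝ) + u j) • b j‖ ^ 2) := by
  -- The added `1` keeps the divisor positive in rank 0.
  have hK : 0 < 1 + ∑ j, ‖d j‖ ^ 2 := by positivity
  refine (summable_gaussian_pi (div_pos hs hK) u).of_nonneg_of_le
    (fun _ => (Real.exp_pos _).le) fun x => Real.exp_le_exp.2 ?_
  have h1 := sum_sq_le_of_biorthogonal h (fun j => (x j : ℝ) + u j)
  have h2 : ∑ j, ((x j : ℝ) + u j) ^ 2 ≤
      (1 + ∑ j, ‖d j‖ ^ 2) * ‖∑ j, ((x j : ℝ) + u j) • b j‖ ^ 2 := by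
    nlinarith [sq_nonneg ‖∑ j, ((x j : ℝ) + u j) • b j‖]
  have h3 : s / (1 + ∑ j, ‖d j‖ ^ 2) * ∑ j, ((x j : ℝ) + u j) ^ 2 ≤
      s * ‖∑ j, ((x j : ℝ) + u j) • b j‖ ^ 2 := by
    rw [div_mul_eq_mul_div, div_le_iff₀ hK]
    nlinarith [mul_le_mul_of_nonneg_left h2 hs.le]
  nlinarith [mul_le_mul_of_nonneg_left h3 Real.pi_pos.le]

theorem summable_gaussianTerm {n : ℕ} {b d : Fin n → V}
    (h : ∀ i j, inner ℝ (d i) (b j) = if i = j then (1 : ℝ) else 0) {s : ℝ} (hs : 0 < s)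
    (u z : Fin n → ℝ) : Summable (gaussianTerm s b u z) := by
  refine Summable.of_norm ?_
  simp_rw [norm_gaussianTerm]
  exact summable_gaussian h hs u

theorem gaussianSum_eq_tsum_tsum {n : ℕ} {b d : Fin (n + 1) → V}
    (h : ∀ i j, inner ℝ (d i) (b j) = if i = j then (1 : ℝ) else 0) {s : ℝ} (hs : 0 < s)
    (u z : Fin (n + 1) → ℝ) :
    gaussianSum s b u z = ∑' x₀ : ℤ, ∑' x : Fin n → ℤ, gaussianTerm s b u z (Fin.cons x₀ x) := by
  have hS := summable_gaussianTerm h hs u z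
  rw [gaussianSum, ← (Fin.consEquiv fun _ : Fin (n + 1) => ℤ).tsum_eq]
  rw [← (Fin.consEquiv fun _ : Fin (n + 1) => ℤ).summable_iff] at hS
  exact hS.tsum_prod

theorem norm_sq_sum_smul_of_orthogonal_split {n : ℕ} (b₀ : V) (w : Fin n → V)
    (hw : ∀ j, inner ℝ b₀ (w j) = 0) (c₀ : ℝ) (c : Fin n → ℝ) :
    ‖c₀ • b₀ + ∑ j, c j • w j‖ ^ 2 = c₀ ^ 2 * ‖b₀‖ ^ 2 + ‖∑ j, c j • w j‖ ^ 2 := by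
  have h : inner ℝ (c₀ • b₀) (∑ j, c j • w j) = 0 := by
    simp [inner_sum, inner_smul_left, inner_smul_right, hw]
  have := norm_add_sq_eq_norm_sq_add_norm_sq_of_inner_eq_zero _ _ h
  rw [norm_smul] at this
  rw [sq, this, Real.norm_eq_abs]
  nlinarith [sq_abs c₀]

end GaussianSums

/-! ### Poisson summation in arbitrary rank. -/

section Poisson

open Real Complex

variable {V : Type*} [NormedAddCommGroup V] [InnerProductSpace ℝ V]

/-- Peeling off the first basis vector of a Gaussian term, primal side. -/
theorem gaussianTerm_cons {n : ℕ} {b : Fin (n + 1) → V} {w : Fin n → V} {l : Fin n → ℝ}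
    (hb : ∀ j, b j.succ = w j + l j • b 0) (hw : ∀ j, inner ℝ (b 0) (w j) = 0)
    (s : ℝ) (u z : Fin (n + 1) → ℝ) (x₀ : ℤ) (x : Fin n → ℤ) :
    gaussianTerm s b u z (Fin.cons x₀ x) =
      cexp (((-π * (s * ‖b 0‖ ^ 2) *
          ((x₀ : ℝ) + (u 0 + ∑ j, ((x j : ℝ) + u j.succ) * l j)) ^ 2 : ℝ) : ℂ)
        + ((2 * π * (z 0 * ((x₀ : ℝ) + (u 0 + ∑ j, ((x j : ℝ) + u j.succ) * l j))) : ℝ) : ℂ) * I) *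
      (cexp (((2 * π * (-(z 0) * ∑ j, ((x j : ℝ) + u j.succ) * l j) : ℝ) : ℂ) * I) *
        gaussianTerm s w (fun j => u j.succ) (fun j => z j.succ) x) := by
  have h1 : ∑ j, (((Fin.cons x₀ x : Fin (n + 1) → ℤ) j : ℝ) + u j) • b j =
      ((x₀ : ℝ) + (u 0 + ∑ j, ((x j : ℝ) + u j.succ) * l j)) • b 0 +
        ∑ j, ((x j : ℝ) + u j.succ) • w j := by
    rw [Fin.sum_univ_succ]
    simp only [Fin.cons_zero, Fin.cons_succ, hb, smul_add, Finset.sum_add_distrib, smul_smul,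
      add_smul, Finset.sum_smul]
    abel
  simp only [gaussianTerm]
  rw [h1, norm_sq_sum_smul_of_orthogonal_split _ _ hw, ← Complex.exp_add, ← Complex.exp_add,
    Fin.sum_univ_succ]
  simp only [Fin.cons_zero, Fin.cons_succ]
  congr 1
  push_cast
  ring

/-- Peeling off the first basis vector of a Gaussian term, dual side. -/
theorem gaussianTerm_cons_dual {n : ℕ} {b₀ : V} {d : Fin (n + 1) → V} {l : Fin n → ℝ}
    (hb₀ : b₀ ≠ 0)
    (hd : d 0 = (‖b₀‖ ^ 2)⁻¹ • b₀ - ∑ j, l j • d j.succ) (hw : ∀ j : Fin n, inner ℝ b₀ (d j.succ) = 0)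
    {s : ℝ} (hs : 0 < s) (u z : Fin (n + 1) → ℝ) (y₀ : ℤ) (y : Fin n → ℤ) :
    cexp (((2 * π * ∑ j, u j * z j : ℝ) : ℂ) * I) * gaussianTerm s⁻¹ d (-z) u (Fin.cons y₀ y) =
      cexp (((-π * (s * ‖b₀‖ ^ 2)⁻¹ * ((y₀ : ℝ) - z 0) ^ 2 : ℝ) : ℂ)
        + ((2 * π * (y₀ * u 0) : ℝ) : ℂ) * I) *
      (cexp (((2 * π * ∑ j : Fin n, u j.succ * (z j.succ + ((y₀ : ℝ) - z 0) * l j) : ℝ) : ℂ) * I) *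
        gaussianTerm s⁻¹ (fun j => d j.succ) (-fun j => z j.succ + ((y₀ : ℝ) - z 0) * l j)
          (fun j => u j.succ) y) := by
  have h1 : ∑ j, (((Fin.cons y₀ y : Fin (n + 1) → ℤ) j : ℝ) + (-z) j) • d j =
      (((y₀ : ℝ) - z 0) * (‖b₀‖ ^ 2)⁻¹) • b₀ +
        ∑ j : Fin n, ((y j : ℝ) + (-fun j => z j.succ + ((y₀ : ℝ) - z 0) * l j) j) • d j.succ := by
    rw [Fin.sum_univ_succ]
    simp only [Fin.cons_zero, Fin.cons_succ, hd, Pi.neg_apply, ← sub_eq_add_neg]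
    rw [smul_sub, smul_smul, Finset.smul_sum]
    simp only [sub_smul, add_smul, Finset.sum_sub_distrib, Finset.sum_add_distrib, smul_smul]
    abel
  have hB : (‖b₀‖ : ℂ) ≠ 0 := by simpa using hb₀
  have hs' : (s : ℂ) ≠ 0 := by exact_mod_cast hs.ne'
  have h2 : ∑ j : Fin n, u j.succ * (z j.succ + ((y₀ : ℝ) - z 0) * l j) +
      ∑ j : Fin n, u j.succ * ((y j : ℝ) + (-fun j => z j.succ + ((y₀ : ℝ) - z 0) * l j) j) =
      ∑ j : Fin n, u j.succ * y j := by
    rw [← Finset.sum_add_distrib]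
    exact Finset.sum_congr rfl fun j _ => by rw [Pi.neg_apply]; ring
  have h3 : ∑ j, u j * z j + ∑ j, u j * (((Fin.cons y₀ y : Fin (n + 1) → ℤ) j : ℝ) + (-z) j) =
      u 0 * y₀ + ∑ j : Fin n, u j.succ * y j := by
    rw [← Finset.sum_add_distrib, Fin.sum_univ_succ]
    simp [mul_add]
  simp only [gaussianTerm]
  rw [h1, norm_sq_sum_smul_of_orthogonal_split _ _ hw, ← Complex.exp_add, ← Complex.exp_add,
    ← Complex.exp_add]
  rw [← eq_sub_iff_add_eq'] at h2 h3
  rw [h2, h3]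
  congr 1
  push_cast
  field_simp
  ring

/-- Induction on the rank: project the other basis vectors orthogonally to `b 0`, apply the rank-one
formula to the first coordinate and the induction hypothesis to the rest. Projection leaves the
remaining dual vectors unchanged, but the first dual coordinate enters the phase of the remaining
sum, so the statement must allow arbitrary translation and phase. `D` does not depend on `s`, `u`,
`z`; only this uniformity is used later, not its value. -/
theorem exists_gaussianSum_eq_dual {n : ℕ} : ∀ {b d : Fin n → V},
    (∀ i j, inner ℝ (d i) (b j) = if i = j then (1 : ℝ) else 0) →
    (∀ i, d i ∈ Submodule.span ℝ (Set.range b)) →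
    ∃ D : ℝ, 0 < D ∧ ∀ s : ℝ, 0 < s → ∀ u z : Fin n → ℝ,
      gaussianSum s b u z = ((D * s ^ (-(n : ℝ) / 2) : ℝ) : ℂ) *
        (cexp (((2 * π * ∑ j, u j * z j : ℝ) : ℂ) * I) * gaussianSum s⁻¹ d (-z) u) := by
  induction n with
  | zero =>
    intro b d _ _
    refine ⟨1, one_pos, fun s _ u z => ?_⟩
    simp [gaussianSum, gaussianTerm]
  | succ n ih =>
    intro b d h hspan
    have h' : ∀ i j, inner ℝ (b i) (d j) = if i = j then (1 : ℝ) else 0 := fun i j => by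
      rw [real_inner_comm, h]; simp [eq_comm]
    have hb₀ : b 0 ≠ 0 := fun h0 => by simpa [h0] using h 0 0
    have hB : 0 < ‖b 0‖ ^ 2 := by positivity
    set l : Fin n → ℝ := fun j => inner ℝ (b 0) (b j.succ) / ‖b 0‖ ^ 2 with hl
    set w : Fin n → V := fun j => b j.succ - l j • b 0 with hwdef
    have hbw : ∀ j, b j.succ = w j + l j • b 0 := fun j => by simp [hwdef]
    have hw : ∀ j, inner ℝ (b 0) (w j) = 0 := fun j => by
      simp only [hwdef, hl, inner_sub_right, inner_smul_right, real_inner_self_eq_norm_sq]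
      field_simp
      ring
    have hdb : ∀ j : Fin n, inner ℝ (b 0) (d j.succ) = 0 := fun j => by
      rw [h']; simp [(Fin.succ_ne_zero j).symm]
    have hwd : ∀ i j, inner ℝ (d i.succ) (w j) = if i = j then (1 : ℝ) else 0 := fun i j => by
      simp [hwdef, inner_sub_right, inner_smul_right, h]
    have hdecomp : ∀ v ∈ Submodule.span ℝ (Set.range b), ∃ c : ℝ,
        ∃ v' ∈ Submodule.span ℝ (Set.range w), v = c • b 0 + v' := by
      intro v hv
      obtain ⟨c, rfl⟩ := (Submodule.mem_span_range_iff_exists_fun ℝ).1 hv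
      refine ⟨c 0 + ∑ j : Fin n, c j.succ * l j, ∑ j : Fin n, c j.succ • w j,
        Submodule.sum_mem _ fun j _ => Submodule.smul_mem _ _ (Submodule.subset_span ⟨j, rfl⟩), ?_⟩
      rw [Fin.sum_univ_succ]
      simp only [hbw, smul_add, Finset.sum_add_distrib, smul_smul, add_smul, Finset.sum_smul]
      abel
    have hw0 : ∀ v' ∈ Submodule.span ℝ (Set.range w), inner ℝ (b 0) v' = 0 := by
      intro v' hv'
      obtain ⟨c, rfl⟩ := (Submodule.mem_span_range_iff_exists_fun ℝ).1 hv'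
      simp [inner_sum, inner_smul_right, hw]
    have hspan' : ∀ i : Fin n, d i.succ ∈ Submodule.span ℝ (Set.range w) := by
      intro i
      obtain ⟨c, v', hv', hc⟩ := hdecomp _ (hspan i.succ)
      have h1 := hdb i
      rw [hc, inner_add_right, inner_smul_right, hw0 _ hv', real_inner_self_eq_norm_sq] at h1
      have h2 : c = 0 := by
        rcases mul_eq_zero.1 (by simpa using h1 : c * ‖b 0‖ ^ 2 = 0) with h | h
        · exact h
        · exact absurd h hB.ne'
      rw [hc, h2, zero_smul, zero_add]
      exact hv'
    -- The difference of the two sides lies in the span of `b` and is orthogonal to every `b k`.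
    have hd0 : d 0 = (‖b 0‖ ^ 2)⁻¹ • b 0 - ∑ j, l j • d j.succ := by
      have hmem : d 0 - ((‖b 0‖ ^ 2)⁻¹ • b 0 - ∑ j, l j • d j.succ) ∈
          Submodule.span ℝ (Set.range b) := by
        refine Submodule.sub_mem _ (hspan 0) (Submodule.sub_mem _ (Submodule.smul_mem _ _
          (Submodule.subset_span ⟨0, rfl⟩)) (Submodule.sum_mem _ fun j _ =>
            Submodule.smul_mem _ _ (hspan _)))
      have hz : ∀ k, inner ℝ (b k) (d 0 - ((‖b 0‖ ^ 2)⁻¹ • b 0 - ∑ j, l j • d j.succ)) = 0 := by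
        intro k
        refine Fin.cases ?_ (fun k => ?_) k
        · simp [inner_sub_right, inner_smul_right, inner_sum, h', (Fin.succ_ne_zero _).symm, hb₀]
        · simp only [inner_sub_right, inner_smul_right, inner_sum, h', Fin.succ_inj,
            real_inner_comm (b 0) (b k.succ)]
          simp only [Fin.succ_ne_zero, if_false, mul_ite, mul_one, mul_zero, Finset.sum_ite_eq,
            Finset.mem_univ, if_true, hl]
          ring
      obtain ⟨c, hc⟩ := (Submodule.mem_span_range_iff_exists_fun ℝ).1 hmem
      rw [← sub_eq_zero, ← inner_self_eq_zero (𝕜 := ℝ)]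
      nth_rewrite 1 [← hc]
      simp [sum_inner, inner_smul_left, hz]
    obtain ⟨D, hD, hP⟩ := ih hwd hspan'
    refine ⟨D * (‖b 0‖ ^ 2) ^ (-(1 / 2) : ℝ), by positivity, fun s hs u z => ?_⟩
    have hsB : 0 < s * ‖b 0‖ ^ 2 := by positivity
    -- summand mixing the first dual coordinate `y₀` with the remaining primal coordinates `x`
    let F : ℤ → (Fin n → ℤ) → ℂ := fun y₀ x =>
      cexp (((-π * (s * ‖b 0‖ ^ 2)⁻¹ * ((y₀ : ℝ) - z 0) ^ 2 : ℝ) : ℂ)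
        + ((2 * π * (y₀ * u 0) : ℝ) : ℂ) * I) *
      gaussianTerm s w (fun j => u j.succ) (fun j => z j.succ + ((y₀ : ℝ) - z 0) * l j) x
    have hF : Summable (Function.uncurry F) := by
      refine Summable.of_norm ?_
      have hsum := (summable_gaussian_int (inv_pos.2 hsB) (-(z 0))).mul_of_nonneg
        (summable_gaussian hwd hs (fun j => u j.succ))
        (fun _ => (Real.exp_pos _).le) (fun _ => (Real.exp_pos _).le)
      refine hsum.congr fun p => ?_
      simp only [Function.uncurry, F]
      rw [norm_mul, norm_gaussianTerm, Complex.exp_add, norm_mul, Complex.norm_exp_ofReal_mul_I,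
        mul_one, ← Complex.ofReal_exp, Complex.norm_real, Real.norm_eq_abs,
        abs_of_pos (Real.exp_pos _), sub_eq_add_neg]
    have hinner : ∀ x : Fin n → ℤ, ∑' x₀ : ℤ, gaussianTerm s b u z (Fin.cons x₀ x) =
        (((s * ‖b 0‖ ^ 2) ^ (-(1 / 2) : ℝ) : ℝ) : ℂ) * ∑' y₀, F y₀ x := by
      intro x
      simp_rw [gaussianTerm_cons hbw hw]
      -- Rank-one Poisson in `x₀`, whose translation depends on `x`; dualizing turns that dependence
      -- into a phase.
      rw [tsum_mul_right, tsum_gaussian_int hsB, mul_assoc, ← tsum_mul_right]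
      congr 1
      refine tsum_congr fun y₀ => ?_
      have h4 : ∑ j : Fin n, (z j.succ + ((y₀ : ℝ) - z 0) * l j) * ((x j : ℝ) + u j.succ) =
          ∑ j : Fin n, z j.succ * ((x j : ℝ) + u j.succ) +
            ((y₀ : ℝ) - z 0) * ∑ j : Fin n, ((x j : ℝ) + u j.succ) * l j := by
        rw [Finset.mul_sum, ← Finset.sum_add_distrib]
        exact Finset.sum_congr rfl fun j _ => by ring
      simp only [F, gaussianTerm]
      rw [h4, ← Complex.exp_add, ← Complex.exp_add, ← Complex.exp_add]
      congr 1
      push_cast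
      ring
    have hswap : gaussianSum s b u z = ∑' x : Fin n → ℤ, ∑' x₀ : ℤ,
        gaussianTerm s b u z (Fin.cons x₀ x) := by
      rw [gaussianSum_eq_tsum_tsum h hs]
      have hS := summable_gaussianTerm h hs u z
      rw [← (Fin.consEquiv fun _ : Fin (n + 1) => ℤ).summable_iff] at hS
      exact (Summable.tsum_comm
        (f := fun (x₀ : ℤ) (x : Fin n → ℤ) => gaussianTerm s b u z (Fin.cons x₀ x)) hS).symm
    have houter : ∀ y₀ : ℤ, ∑' x, F y₀ x = ((D * s ^ (-(n : ℝ) / 2) : ℝ) : ℂ) *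
        (cexp (((2 * π * ∑ j, u j * z j : ℝ) : ℂ) * I) *
          ∑' y : Fin n → ℤ, gaussianTerm s⁻¹ d (-z) u (Fin.cons y₀ y)) := by
      intro y₀
      simp only [F]
      rw [tsum_mul_left]
      change _ * gaussianSum s w _ _ = _
      rw [hP s hs, ← tsum_mul_left]
      simp_rw [gaussianTerm_cons_dual hb₀ hd0 hdb hs]
      rw [tsum_mul_left, tsum_mul_left, gaussianSum]
      ring
    rw [hswap, gaussianSum_eq_tsum_tsum h' (inv_pos.2 hs)]
    simp_rw [hinner]
    rw [tsum_mul_left, Summable.tsum_comm hF]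
    simp_rw [houter]
    rw [tsum_mul_left, tsum_mul_left]
    have h5 : (s * ‖b 0‖ ^ 2) ^ (-(1 / 2) : ℝ) * (D * s ^ (-(n : ℝ) / 2)) =
        D * (‖b 0‖ ^ 2) ^ (-(1 / 2) : ℝ) * s ^ (-((n + 1 : ℕ) : ℝ) / 2) := by
      have : (-((n + 1 : ℕ) : ℝ) / 2) = -(1 / 2) + -(n : ℝ) / 2 := by push_cast; ring
      rw [this, Real.rpow_add hs, Real.mul_rpow hs.le hB.le]
      ring
    rw [← h5]
    push_cast
    ring

end Poisson

/-! ### Banaszczyk's transference bound. -/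

section Transference

open Real

variable {V : Type*} [NormedAddCommGroup V] [InnerProductSpace ℝ V]

/-- The Gaussian mass of the translate by `u` of the lattice generated by `b`. -/
noncomputable def gaussianMass {n : ℕ} (s : ℝ) (b : Fin n → V) (u : Fin n → ℝ) : ℝ :=
  ∑' x : Fin n → ℤ, rexp (-π * s * ‖∑ j, ((x j : ℝ) + u j) • b j‖ ^ 2)

theorem gaussianSum_zero_phase {n : ℕ} (s : ℝ) (b : Fin n → V) (u : Fin n → ℝ) :
    gaussianSum s b u 0 = (gaussianMass s b u : ℂ) := by
  rw [gaussianSum, gaussianMass, Complex.ofReal_tsum]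
  refine tsum_congr fun x => ?_
  simp [gaussianTerm]

variable {n : ℕ} {b d : Fin n → V}

theorem biorthogonal_symm (h : ∀ i j, inner ℝ (d i) (b j) = if i = j then (1 : ℝ) else 0) :
    ∀ i j, inner ℝ (b i) (d j) = if i = j then (1 : ℝ) else 0 := fun i j => by
  rw [real_inner_comm, h]; simp [eq_comm]

theorem norm_gaussianSum_le
    (h : ∀ i j, inner ℝ (d i) (b j) = if i = j then (1 : ℝ) else 0) {s : ℝ} (hs : 0 < s)
    (u z : Fin n → ℝ) : ‖gaussianSum s b u z‖ ≤ gaussianMass s b u := by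
  have h1 : Summable fun x => ‖gaussianTerm s b u z x‖ := by
    simp_rw [norm_gaussianTerm]; exact summable_gaussian h hs u
  refine (norm_tsum_le_tsum_norm h1).trans_eq (tsum_congr fun x => norm_gaussianTerm s b u z x)

/-- Each term satisfies `Re z + |z| ≥ 0`, and the origin alone contributes 2. -/
theorem two_sub_gaussianMass_le_re
    (h : ∀ i j, inner ℝ (d i) (b j) = if i = j then (1 : ℝ) else 0) {s : ℝ} (hs : 0 < s)
    (z : Fin n → ℝ) : 2 - gaussianMass s b 0 ≤ (gaussianSum s b 0 z).re := by
  have h1 := summable_gaussianTerm h hs 0 z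
  have h2 := summable_gaussian h hs 0
  have h3 : Summable fun x => (gaussianTerm s b 0 z x).re := (Complex.hasSum_re h1.hasSum).summable
  have h4 : (gaussianSum s b 0 z).re = ∑' x, (gaussianTerm s b 0 z x).re := Complex.re_tsum h1
  have h5 := (h3.add h2).le_tsum 0 (fun x _ => by
    rw [← norm_gaussianTerm s b 0 z x]
    linarith [(abs_le.1 (Complex.abs_re_le_norm (gaussianTerm s b 0 z x))).1])
  rw [h3.tsum_add h2] at h5
  have h6 : (gaussianTerm s b 0 z 0).re + rexp (-π * s * ‖∑ j, (((0 : Fin n → ℤ) j : ℝ) +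
      (0 : Fin n → ℝ) j) • b j‖ ^ 2) = 2 := by
    simp [gaussianTerm]; norm_num
  rw [h6, ← h4] at h5
  change _ ≤ _ + gaussianMass s b 0 at h5
  linarith

/-- Dualizing a translate with zero phase gives an untranslated dual sum with phase `u`. Its real
part lies between `2 - T` and `T`, where `T` is the dual mass. -/
theorem exists_gaussianMass_bounds
    (h : ∀ i j, inner ℝ (d i) (b j) = if i = j then (1 : ℝ) else 0)
    (hd : ∀ i, d i ∈ Submodule.span ℝ (Set.range b)) :
    ∃ D : ℝ, 0 < D ∧ ∀ s : ℝ, 0 < s →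
      gaussianMass s b 0 = D * s ^ (-(n : ℝ) / 2) * gaussianMass s⁻¹ d 0 ∧
      ∀ u, gaussianMass s b u ≤ D * s ^ (-(n : ℝ) / 2) * gaussianMass s⁻¹ d 0 ∧
        D * s ^ (-(n : ℝ) / 2) * (2 - gaussianMass s⁻¹ d 0) ≤ gaussianMass s b u := by
  obtain ⟨D, hD, hP⟩ := exists_gaussianSum_eq_dual h hd
  have h' := biorthogonal_symm h
  refine ⟨D, hD, fun s hs => ?_⟩
  have hc : 0 < D * s ^ (-(n : ℝ) / 2) := by positivity
  have key : ∀ u, (gaussianMass s b u : ℂ) =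
      ((D * s ^ (-(n : ℝ) / 2) : ℝ) : ℂ) * gaussianSum s⁻¹ d 0 u := fun u => by
    have := hP s hs u 0
    rw [gaussianSum_zero_phase] at this
    simpa using this
  have hre : ∀ u, gaussianMass s b u =
      D * s ^ (-(n : ℝ) / 2) * (gaussianSum s⁻¹ d 0 u).re := fun u => by
    have := congrArg Complex.re (key u)
    rwa [Complex.ofReal_re, Complex.re_ofReal_mul] at this
  refine ⟨?_, fun u => ⟨?_, ?_⟩⟩
  · rw [hre 0, gaussianSum_zero_phase, Complex.ofReal_re]
  · rw [hre u]
    exact mul_le_mul_of_nonneg_left ((Complex.re_le_norm _).trans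
      (norm_gaussianSum_le h' (inv_pos.2 hs) 0 u)) hc.le
  · rw [hre u]
    exact mul_le_mul_of_nonneg_left (two_sub_gaussianMass_le_re h' (inv_pos.2 hs) u) hc.le

/-- Passing from `s'` to `s` multiplies each term by a Gaussian factor, largest at the smallest
norm. -/
theorem gaussianMass_le_of_le
    (h : ∀ i j, inner ℝ (d i) (b j) = if i = j then (1 : ℝ) else 0) {s s' : ℝ} (hs' : 0 < s')
    (hss : s' ≤ s) (u : Fin n → ℝ) {R : ℝ} (hR0 : 0 ≤ R)
    (hR : ∀ x : Fin n → ℤ, R ≤ ‖∑ j, ((x j : ℝ) + u j) • b j‖) :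
    gaussianMass s b u ≤ rexp (-π * (s - s') * R ^ 2) * gaussianMass s' b u := by
  rw [gaussianMass, gaussianMass, ← tsum_mul_left]
  refine (summable_gaussian h (hs'.trans_le hss) u).tsum_le_tsum (fun x => ?_)
    ((summable_gaussian h hs' u).mul_left _)
  rw [← Real.exp_add]
  have h1 := pow_le_pow_left₀ hR0 (hR x) 2
  have h2 := mul_le_mul_of_nonneg_left h1 (mul_nonneg pi_pos.le (sub_nonneg.2 hss))
  exact Real.exp_le_exp.2 (by linarith)

theorem gaussianMass_anti
    (h : ∀ i j, inner ℝ (d i) (b j) = if i = j then (1 : ℝ) else 0) {s s' : ℝ} (hs' : 0 < s')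
    (hss : s' ≤ s) (u : Fin n → ℝ) : gaussianMass s b u ≤ gaussianMass s' b u := by
  simpa using gaussianMass_le_of_le h hs' hss u le_rfl (fun x => norm_nonneg _)

theorem gaussianMass_zero_le
    (h : ∀ i j, inner ℝ (d i) (b j) = if i = j then (1 : ℝ) else 0) {s s' : ℝ} (hs' : 0 < s')
    (hss : s' ≤ s) {R : ℝ} (hR0 : 0 ≤ R)
    (hR : ∀ x : Fin n → ℤ, x ≠ 0 → R ≤ ‖∑ j, (x j : ℝ) • b j‖) :
    gaussianMass s b 0 ≤ 1 + rexp (-π * (s - s') * R ^ 2) * gaussianMass s' b 0 := by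
  have h1 := hasSum_ite_eq (0 : Fin n → ℤ) (1 : ℝ)
  have h2 := (summable_gaussian h hs' 0).mul_left (rexp (-π * (s - s') * R ^ 2))
  have h3 : gaussianMass s b 0 ≤ _ := (summable_gaussian h (hs'.trans_le hss) 0).tsum_le_tsum
    (fun x => ?_) (h1.summable.add h2)
  · rwa [h1.summable.tsum_add h2, h1.tsum_eq, tsum_mul_left] at h3
  · by_cases hx : x = 0
    · subst hx
      simp only [if_true]
      have : rexp (-π * s * ‖∑ j, (((0 : Fin n → ℤ) j : ℝ) + (0 : Fin n → ℝ) j) • b j‖ ^ 2) = 1 := by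
        simp
      rw [this]
      have : 0 ≤ rexp (-π * (s - s') * R ^ 2) * rexp (-π * s' * ‖∑ j, (((0 : Fin n → ℤ) j : ℝ) +
        (0 : Fin n → ℝ) j) • b j‖ ^ 2) := by positivity
      linarith
    · rw [if_neg hx, zero_add, ← Real.exp_add]
      have hRx := hR x hx
      simp only [Pi.zero_apply, add_zero]
      have h4 := pow_le_pow_left₀ hR0 hRx 2
      have h5 := mul_le_mul_of_nonneg_left h4 (mul_nonneg pi_pos.le (sub_nonneg.2 hss))
      exact Real.exp_le_exp.2 (by linarith)

/-- The left side is at most `(a * exp (-c)) ^ (N / 2)`. As the base is at most 1 and `N / 2 ≥ 1`,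
the worst case is `N = 2`, which makes the estimate uniform in the rank. -/
theorem exp_mul_rpow_le {a c t N : ℝ} (ha : 0 < a) (hN : 2 ≤ N) (hc : c * N / 2 ≤ t)
    (hac : a * rexp (-c) ≤ 1) : rexp (-t) * a ^ (N / 2) ≤ a * rexp (-c) := by
  calc rexp (-t) * a ^ (N / 2) ≤ rexp (-(c * N / 2)) * a ^ (N / 2) := by gcongr
    _ = (a * rexp (-c)) ^ (N / 2) := by
      rw [Real.mul_rpow ha.le (Real.exp_pos _).le, ← Real.exp_mul]
      rw [mul_comm]
      congr 2
      ring
    _ ≤ (a * rexp (-c)) ^ (1 : ℝ) :=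
      Real.rpow_le_rpow_of_exponent_ge (by positivity) hac (by linarith)
    _ = _ := Real.rpow_one _

theorem exp_neg_three_halves_lt : rexp (-(3 / 2)) < 0.2233 := by
  have h1 : (rexp (3 / 2)) ^ 2 = rexp 1 ^ 3 := by
    rw [← Real.exp_nat_mul, ← Real.exp_nat_mul]; norm_num
  have h2 : (2.7182818283 : ℝ) ^ 3 < rexp 1 ^ 3 := by
    gcongr; exact Real.exp_one_gt_d9
  have h3 : 4.48 < rexp (3 / 2) := by
    refine lt_of_pow_lt_pow_left₀ 2 (Real.exp_pos _).le ?_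
    rw [h1]; refine lt_trans ?_ h2; norm_num
  rw [Real.exp_neg, inv_lt_comm₀ (Real.exp_pos _) (by norm_num)]
  refine lt_trans ?_ h3
  norm_num

theorem exp_neg_lt : rexp (-2.955) < 0.0523 := by
  have h2 : (2.7182818283 : ℝ) ^ 3 < rexp 1 ^ 3 := by
    gcongr; exact Real.exp_one_gt_d9
  have h1 : rexp 2.955 = rexp 1 ^ 3 * rexp (-0.045) := by
    rw [← Real.exp_nat_mul, ← Real.exp_add]; norm_num
  have h3 := Real.add_one_le_exp (-0.045 : ℝ)
  have h4 : 19.15 < rexp 2.955 := by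
    rw [h1]
    have h5 : (20 : ℝ) + 0.08 < rexp 1 ^ 3 := lt_trans (by norm_num) h2
    nlinarith
  rw [Real.exp_neg, inv_lt_comm₀ (Real.exp_pos _) (by norm_num)]
  refine lt_trans ?_ h4
  norm_num

/-- If a translate avoids the ball of radius `R`, its mass is small; if the nonzero dual vectors are
long, the dual mass `T` is near 1 and Poisson forces every translate to have large mass. The two are
incompatible. -/
theorem exists_norm_le_of_dual_minimum_of_two_le
    (h : ∀ i j, inner ℝ (d i) (b j) = if i = j then (1 : ℝ) else 0)
    (hd : ∀ i, d i ∈ Submodule.span ℝ (Set.range b)) (hn : 2 ≤ n) {ℓ R : ℝ} (hℓ : 0 ≤ ℓ)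
    (hR : 0 ≤ R) (hℓR : (n : ℝ) / 2 ≤ ℓ * R)
    (hmin : ∀ y : Fin n → ℤ, y ≠ 0 → ℓ ≤ ‖∑ j, (y j : ℝ) • d j‖) (u : Fin n → ℝ) :
    ∃ x : Fin n → ℤ, ‖∑ j, ((x j : ℝ) + u j) • b j‖ ≤ R := by
  by_contra! hcon
  have hn' : (2 : ℝ) ≤ n := by exact_mod_cast hn
  have h' := biorthogonal_symm h
  have hRpos : 0 < R := lt_of_le_of_ne hR (by rintro rfl; linarith)
  obtain ⟨D, hD, hP⟩ := exists_gaussianMass_bounds h hd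
  -- Chosen so that `π s R² = 5n/4`. Comparing `s` with `2s/5` on the translate gives the factor
  -- `5/2 · exp (-3/2)`; comparing `1/s` with `1/(4s)` on the dual gives `4 · exp (-2.955)`, since
  -- `3π²/20 > 2.955/2`.
  set s : ℝ := 5 * n / (4 * π * R ^ 2) with hsdef
  have hπ := pi_pos
  have hs : 0 < s := by positivity
  have hsR : π * s * R ^ 2 = 5 * n / 4 := by rw [hsdef]; field_simp
  set T := gaussianMass s⁻¹ d 0 with hT
  set c := D * s ^ (-(n : ℝ) / 2) with hc
  have hcpos : 0 < c := by positivity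
  have hscale : ∀ a : ℝ, 0 < a → D * (a⁻¹ * s) ^ (-(n : ℝ) / 2) = a ^ ((n : ℝ) / 2) * c := by
    intro a ha
    rw [Real.mul_rpow (inv_nonneg.2 ha.le) hs.le, Real.inv_rpow ha.le, ← Real.rpow_neg ha.le, hc]
    rw [show -(-(n : ℝ) / 2) = n / 2 by ring]
    ring
  have hT0 : 0 ≤ T := tsum_nonneg fun _ => (Real.exp_pos _).le
  -- upper bound for the translate
  have hup : gaussianMass s b u ≤ (5 / 2 * rexp (-(3 / 2))) * (c * T) := by
    have hs' : 0 < (5 / 2 : ℝ)⁻¹ * s := by positivity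
    have hss : (5 / 2 : ℝ)⁻¹ * s ≤ s := by linarith
    have h1 := gaussianMass_le_of_le h hs' hss u hR fun x => (hcon x).le
    have h2 := ((hP _ hs').2 u).1
    have h3 : gaussianMass ((5 / 2 : ℝ)⁻¹ * s)⁻¹ d 0 ≤ T :=
      gaussianMass_anti h' (inv_pos.2 hs) (inv_anti₀ hs' hss) 0
    rw [hscale _ (by norm_num)] at h2
    have h4 : -π * (s - (5 / 2 : ℝ)⁻¹ * s) * R ^ 2 = -(3 * n / 4) := by
      linear_combination -(3 / 5) * hsR
    rw [h4] at h1
    have h5 := exp_mul_rpow_le (a := 5 / 2) (c := 3 / 2) (t := 3 * n / 4) (by norm_num) hn'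
      (by linarith) (by linarith [exp_neg_three_halves_lt])
    calc gaussianMass s b u ≤ _ := h1
      _ ≤ rexp (-(3 * n / 4)) * ((5 / 2) ^ ((n : ℝ) / 2) * c * T) := by
        gcongr
        exact h2.trans (by gcongr)
      _ = rexp (-(3 * n / 4)) * (5 / 2) ^ ((n : ℝ) / 2) * (c * T) := by ring
      _ ≤ _ := by gcongr
  have hdual : T ≤ 1 + (4 * rexp (-2.955)) * T := by
    have hs' : 0 < (4 : ℝ) * s := by positivity
    have hss : s ≤ 4 * s := by linarith
    have h1 := gaussianMass_zero_le h' (inv_pos.2 hs') (inv_anti₀ hs hss) hℓ hmin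
    have h2 : gaussianMass (4 * s)⁻¹ d 0 ≤ 4 ^ ((n : ℝ) / 2) * T := by
      have h3 := gaussianMass_anti h hs hss 0
      have h6 := hscale (4⁻¹) (by norm_num)
      rw [inv_inv] at h6
      rw [(hP _ hs').1, (hP _ hs).1, h6, Real.inv_rpow (by norm_num), mul_assoc,
        inv_mul_le_iff₀ (by positivity)] at h3
      refine le_of_mul_le_mul_left (h3.trans_eq ?_) hcpos
      ring
    have h4 : 2.955 * (n : ℝ) / 2 ≤ π * (s⁻¹ - (4 * s)⁻¹) * ℓ ^ 2 := by
      have e1 : π * (s⁻¹ - (4 * s)⁻¹) * ℓ ^ 2 = 3 * π ^ 2 / (5 * n) * (ℓ * R) ^ 2 := by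
        rw [hsdef]; field_simp; ring
      have e2 : ((n : ℝ) / 2) ^ 2 ≤ (ℓ * R) ^ 2 := by gcongr
      have e3 : (3.1415 : ℝ) ^ 2 ≤ π ^ 2 := by gcongr; exact pi_gt_d4.le
      rw [e1]
      calc 2.955 * (n : ℝ) / 2 ≤ 3 * 3.1415 ^ 2 / (5 * n) * (n / 2) ^ 2 := by
            have : 3 * (3.1415 : ℝ) ^ 2 / (5 * n) * (n / 2) ^ 2 = 3 * 3.1415 ^ 2 / 20 * n := by
              field_simp; ring
            rw [this]; nlinarith
        _ ≤ _ := by gcongr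
    have h5 := exp_mul_rpow_le (a := 4) (c := 2.955) (by norm_num) hn' h4
      (by linarith [exp_neg_lt])
    rw [← neg_mul, ← neg_mul] at h5
    have h6 : rexp (-π * (s⁻¹ - (4 * s)⁻¹) * ℓ ^ 2) * gaussianMass (4 * s)⁻¹ d 0 ≤
        4 * rexp (-2.955) * T :=
      calc _ ≤ rexp (-π * (s⁻¹ - (4 * s)⁻¹) * ℓ ^ 2) * (4 ^ ((n : ℝ) / 2) * T) :=
            mul_le_mul_of_nonneg_left h2 (Real.exp_pos _).le
        _ = rexp (-π * (s⁻¹ - (4 * s)⁻¹) * ℓ ^ 2) * 4 ^ ((n : ℝ) / 2) * T := by ring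
        _ ≤ _ := mul_le_mul_of_nonneg_right h5 hT0
    linarith
  have hlow := ((hP s hs).2 u).2
  have hfin : 2 - T ≤ 5 / 2 * rexp (-(3 / 2)) * T := by
    refine le_of_mul_le_mul_left ?_ hcpos
    calc _ ≤ _ := hlow.trans hup
      _ = _ := by ring
  -- Numerically, `hdual` forces `T < 1.27` while `hfin` forces `T > 1.28`.
  have q1 : 4 * rexp (-2.955) * T ≤ 4 * 0.0523 * T := by gcongr; exact exp_neg_lt.le
  have q2 : 5 / 2 * rexp (-(3 / 2)) * T ≤ 5 / 2 * 0.2233 * T := by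
    gcongr; exact exp_neg_three_halves_lt.le
  linarith

/-- In rank one the exponent `n / 2` is below 1, so the Gaussian estimate does not apply; rounding
the coordinate and `‖d 0‖ * ‖b 0‖ = 1` suffice. -/
theorem exists_norm_le_of_dual_minimum_one {b d : Fin 1 → V}
    (h : ∀ i j, inner ℝ (d i) (b j) = if i = j then (1 : ℝ) else 0)
    (hd : ∀ i, d i ∈ Submodule.span ℝ (Set.range b)) {ℓ R : ℝ} (hR : 0 ≤ R)
    (hℓR : 1 / 2 ≤ ℓ * R) (hmin : ∀ y : Fin 1 → ℤ, y ≠ 0 → ℓ ≤ ‖∑ j, (y j : ℝ) • d j‖)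
    (u : Fin 1 → ℝ) : ∃ x : Fin 1 → ℤ, ‖∑ j, ((x j : ℝ) + u j) • b j‖ ≤ R := by
  refine ⟨fun _ => -round (u 0), ?_⟩
  have h1 : ℓ ≤ ‖d 0‖ := by simpa using hmin (fun _ => 1) (fun h0 => by simpa using congrFun h0 0)
  obtain ⟨c, hc⟩ := (Submodule.mem_span_range_iff_exists_fun ℝ).1 (hd 0)
  have h2 : c 0 * ‖b 0‖ ^ 2 = 1 := by
    simpa [← hc, inner_smul_left, real_inner_self_eq_norm_sq] using h 0 0
  have h3 : ‖d 0‖ * ‖b 0‖ = 1 := by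
    rw [← hc, Fin.sum_univ_one, norm_smul, mul_assoc, ← sq, Real.norm_eq_abs,
      ← abs_of_nonneg (sq_nonneg ‖b 0‖), ← abs_mul, h2, abs_one]
  have h4 := abs_sub_round (u 0)
  rw [Fin.sum_univ_one, norm_smul, Real.norm_eq_abs]
  have h5 : |((-round (u 0) : ℤ) : ℝ) + u 0| ≤ 1 / 2 := by
    rw [Int.cast_neg, neg_add_eq_sub]; exact h4
  calc _ ≤ 1 / 2 * ‖b 0‖ := by gcongr
    _ ≤ (ℓ * R) * ‖b 0‖ := by gcongr
    _ ≤ (‖d 0‖ * R) * ‖b 0‖ := by gcongr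
    _ = R := by linear_combination R * h3

/-- Banaszczyk's transference theorem: if all nonzero dual vectors have norm at least `ℓ` and
`ℓ * R ≥ n / 2`, then the covering radius is at most `R`. -/
theorem exists_norm_le_of_dual_minimum
    (h : ∀ i j, inner ℝ (d i) (b j) = if i = j then (1 : ℝ) else 0)
    (hd : ∀ i, d i ∈ Submodule.span ℝ (Set.range b)) (hn : 1 ≤ n) {ℓ R : ℝ} (hℓ : 0 ≤ ℓ)
    (hR : 0 ≤ R) (hℓR : (n : ℝ) / 2 ≤ ℓ * R)
    (hmin : ∀ y : Fin n → ℤ, y ≠ 0 → ℓ ≤ ‖∑ j, (y j : ℝ) • d j‖) (u : Fin n → ℝ) :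
    ∃ x : Fin n → ℤ, ‖∑ j, ((x j : ℝ) + u j) • b j‖ ≤ R := by
  rcases hn.eq_or_lt with rfl | hn
  · exact exists_norm_le_of_dual_minimum_one h hd hR (by simpa using hℓR) hmin u
  · exact exists_norm_le_of_dual_minimum_of_two_le h hd hn hℓ hR hℓR hmin u

end Transference

/-! ### Orthogonality of Gram–Schmidt vectors. -/

section GramSchmidt

open InnerProductSpace Submodule

variable {E : Type*} [NormedAddCommGroup E] [InnerProductSpace ℝ E] {n : ℕ}

theorem inner_gramSchmidt_eq_zero_of_mem_span (f : Fin n → E) (q : Fin n) {w : E}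
    (hw : w ∈ span ℝ (f '' Set.Iio q)) : inner ℝ w (gramSchmidt ℝ f q) = 0 := by
  rw [← span_gramSchmidt_Iio ℝ f q] at hw
  induction hw using span_induction with
  | mem x hx =>
    obtain ⟨j, hj, rfl⟩ := hx
    exact gramSchmidt_orthogonal ℝ f (ne_of_lt hj)
  | zero => simp
  | add x y _ _ hx hy => rw [inner_add_left, hx, hy, add_zero]
  | smul a x _ hx => rw [inner_smul_left, hx, mul_zero]

theorem gramSchmidt_sub_mem_span (f : Fin n → E) (q : Fin n) :
    gramSchmidt ℝ f q - f q ∈ span ℝ (f '' Set.Iio q) := by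
  rw [← span_gramSchmidt_Iio ℝ f q, gramSchmidt_def, sub_sub_cancel_left]
  refine neg_mem (sum_mem fun j hj => ?_)
  exact span_mono (by rintro _ rfl; exact ⟨j, Finset.mem_Iio.1 hj, rfl⟩)
    (starProjection_apply_mem (span ℝ {gramSchmidt ℝ f j}) (f q))

theorem norm_sq_add_smul_gramSchmidt (f : Fin n → E) (q : Fin n) {w : E}
    (hw : w ∈ span ℝ (f '' Set.Iio q)) (c : ℝ) :
    ‖w + c • gramSchmidt ℝ f q‖ ^ 2 = ‖w‖ ^ 2 + c ^ 2 * ‖gramSchmidt ℝ f q‖ ^ 2 := by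
  have h : inner ℝ w (c • gramSchmidt ℝ f q) = 0 := by
    rw [inner_smul_right, inner_gramSchmidt_eq_zero_of_mem_span f q hw, mul_zero]
  have := norm_add_sq_eq_norm_sq_add_norm_sq_of_inner_eq_zero _ _ h
  rw [norm_smul, Real.norm_eq_abs] at this
  rw [sq, this]
  nlinarith [sq_abs c]

end GramSchmidt

/-! ### Covering radii of the sublattices of a dual HKZ basis. -/

section DualHKZ

open InnerProductSpace Submodule

variable {n : ℕ} {b d : Fin n → EuclideanSpace ℝ (Fin n)}

theorem mem_latticeOf {k : ℕ} (b : Fin k → EuclideanSpace ℝ (Fin n)) (j : Fin k) :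
    b j ∈ latticeOf b :=
  subset_span ⟨j, rfl⟩

theorem firstMinimum_le {S : Set (EuclideanSpace ℝ (Fin n))} {v : EuclideanSpace ℝ (Fin n)}
    (hv : v ∈ S) (h0 : v ≠ 0) : firstMinimum S ≤ ‖v‖ :=
  csInf_le ⟨0, by rintro _ ⟨w, _, _, rfl⟩; exact norm_nonneg w⟩ ⟨v, hv, h0, rfl⟩

theorem IsReverseDual.mem_orthogonal (h : IsReverseDual b d) (q : Fin n)
    {w : EuclideanSpace ℝ (Fin n)} (hw : w ∈ span ℝ (b '' Set.Iic q)) :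
    w ∈ (span ℝ (d '' Set.Iio (Fin.rev q)))ᗮ := by
  refine (span_le.2 ?_ : span ℝ (b '' Set.Iic q) ≤ _) hw
  rintro _ ⟨j, hj, rfl⟩
  rw [SetLike.mem_coe, Submodule.mem_orthogonal]
  intro x hx
  induction hx using span_induction with
  | mem x hx =>
    obtain ⟨m, hm, rfl⟩ := hx
    rw [h.2, if_neg]
    rintro rfl
    exact absurd (Fin.rev_lt_rev.1 hm) (not_lt.2 hj)
  | zero => simp
  | add x y _ _ hx hy => rw [inner_add_left, hx, hy, add_zero]
  | smul a x _ hx => rw [inner_smul_left, hx, mul_zero]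

theorem IsReverseDual.orthogonal_le (h : IsReverseDual b d) (hb : LinearIndependent ℝ b)
    (q : Fin n) {w : EuclideanSpace ℝ (Fin n)}
    (hw : w ∈ (span ℝ (d '' Set.Iio (Fin.rev q)))ᗮ) : w ∈ span ℝ (b '' Set.Iic q) := by
  have htop : span ℝ (Set.range b) = ⊤ :=
    hb.span_eq_top_of_card_eq_finrank' (by simp)
  obtain ⟨c, rfl⟩ := (mem_span_range_iff_exists_fun ℝ).1 (htop ▸ mem_top : w ∈ span ℝ (Set.range b))
  refine sum_mem fun j _ => ?_
  by_cases hj : j ≤ q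
  · exact smul_mem _ _ (subset_span ⟨j, hj, rfl⟩)
  · have h1 := (Submodule.mem_orthogonal _ _).1 hw (d (Fin.rev j))
      (subset_span ⟨_, Fin.rev_lt_rev.2 (not_le.1 hj), rfl⟩)
    have h2 : c j = 0 := by
      simpa [inner_sum, inner_smul_right, h.2] using h1
    rw [h2, zero_smul]
    exact zero_mem _

/-- The two Gram–Schmidt vectors have inner product `⟪d (rev q), b q⟫ = 1`, because each correction
term is orthogonal to what it is paired with. Cauchy–Schwarz finishes. -/
theorem IsReverseDual.one_le_norm_mul_norm (h : IsReverseDual b d) (q : Fin n) :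
    1 ≤ ‖gramSchmidt ℝ d (Fin.rev q)‖ * ‖gramSchmidt ℝ b q‖ := by
  have hg : gramSchmidt ℝ b q ∈ span ℝ (b '' Set.Iic q) := by
    rw [← span_gramSchmidt_Iic ℝ b q]
    exact subset_span ⟨q, Set.self_mem_Iic, rfl⟩
  have h1 : inner ℝ (gramSchmidt ℝ d (Fin.rev q) - d (Fin.rev q)) (gramSchmidt ℝ b q) = 0 :=
    (Submodule.mem_orthogonal _ _).1 (h.mem_orthogonal q hg) _ (gramSchmidt_sub_mem_span d _)
  have h2 : ∀ w ∈ span ℝ (b '' Set.Iio q), inner ℝ (d (Fin.rev q)) w = 0 := by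
    intro w hw
    induction hw using span_induction with
    | mem x hx =>
      obtain ⟨m, hm, rfl⟩ := hx
      rw [h.2, if_neg]
      intro hqm
      exact absurd (Fin.rev_injective hqm) (ne_of_gt hm)
    | zero => simp
    | add x y _ _ hx hy => rw [inner_add_right, hx, hy, add_zero]
    | smul a x _ hx => rw [inner_smul_right, hx, mul_zero]
  have h3 := h2 _ (gramSchmidt_sub_mem_span b q)
  rw [inner_sub_left, sub_eq_zero] at h1
  rw [inner_sub_right, sub_eq_zero, h.2, if_pos rfl] at h3
  rw [← h3, ← h1]
  exact real_inner_le_norm _ _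

/-- The sublattice generated by the first vectors of a dual HKZ basis has covering radius at most
half its rank times the norm of its last Gram–Schmidt vector. -/
theorem IsDualHKZ.exists_norm_sub_le (hb : IsDualHKZ b) (q : Fin n)
    {w : EuclideanSpace ℝ (Fin n)} (hw : w ∈ span ℝ (b '' Set.Iic q)) :
    ∃ l ∈ latticeOf b, l ∈ span ℝ (b '' Set.Iic q) ∧
      ‖w - l‖ ≤ ((q : ℝ) + 1) / 2 * ‖gramSchmidt ℝ b q‖ := by
  obtain ⟨hlin, d, hrd, hkz⟩ := hb
  set K := span ℝ (d '' Set.Iio (Fin.rev q)) with hK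
  set ι : Fin (q + 1) → Fin n := Fin.castLE (Nat.succ_le_of_lt q.isLt) with hι
  have hιinj : Function.Injective ι := Fin.castLE_injective _
  have hιle : ∀ j, ι j ≤ q := fun j => Fin.le_def.2 (by
    have := j.isLt
    simp only [hι, Fin.val_castLE]; omega)
  have hmemb : ∀ j, b (ι j) ∈ span ℝ (b '' Set.Iic q) := fun j => subset_span ⟨_, hιle j, rfl⟩
  have hrange : span ℝ (b '' Set.Iic q) = span ℝ (Set.range fun j => b (ι j)) := by
    congr 1
    ext x
    constructor
    · rintro ⟨j, hj, rfl⟩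
      exact ⟨⟨j, Nat.lt_succ_of_le hj⟩, rfl⟩
    · rintro ⟨j, rfl⟩
      exact ⟨_, hιle j, rfl⟩
  -- The projected reverse dual vectors form the dual basis of the first `q + 1` vectors of `b`:
  -- projecting onto `Kᗮ` does not change pairings with vectors already in `Kᗮ`.
  have hdual : ∀ i j, inner ℝ (Kᗮ.starProjection (d (Fin.rev (ι i)))) (b (ι j)) =
      if i = j then (1 : ℝ) else 0 := by
    intro i j
    rw [inner_starProjection_left_eq_right,
      starProjection_eq_self_iff.2 (hrd.mem_orthogonal q (hmemb j)), hrd.2]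
    simp [hιinj.eq_iff]
  have hspan : ∀ i, Kᗮ.starProjection (d (Fin.rev (ι i))) ∈
      span ℝ (Set.range fun j => b (ι j)) := fun i => by
    rw [← hrange]
    exact hrd.orthogonal_le hlin q (starProjection_apply_mem _ _)
  obtain ⟨c, rfl⟩ := (mem_span_range_iff_exists_fun ℝ).1 (hrange ▸ hw)
  -- Integer combinations of these vectors lie in the projected lattice, whose first minimum is
  -- prescribed by HKZ reduction; pairing with `b` shows they vanish only for `y = 0`.
  have hmin : ∀ y : Fin (q + 1) → ℤ, y ≠ 0 → ‖gramSchmidt ℝ d (Fin.rev q)‖ ≤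
      ‖∑ j, (y j : ℝ) • Kᗮ.starProjection (d (Fin.rev (ι j)))‖ := by
    intro y hy
    rw [hkz.norm_gramSchmidt]
    refine firstMinimum_le ⟨∑ j, y j • d (Fin.rev (ι j)), ?_, ?_⟩ ?_
    · exact sum_mem fun j _ => zsmul_mem (mem_latticeOf _ _) _
    · simp only [map_sum, map_zsmul, Int.cast_smul_eq_zsmul, hK]
    · intro h0
      refine hy (funext fun k => ?_)
      have h1 : inner ℝ (∑ j, (y j : ℝ) • Kᗮ.starProjection (d (Fin.rev (ι j)))) (b (ι k)) =
          (y k : ℝ) := by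
        simp only [sum_inner, real_inner_smul_left, hdual, mul_ite, mul_one, mul_zero,
          Finset.sum_ite_eq', Finset.mem_univ, if_true]
      rw [h0, inner_zero_left] at h1
      exact_mod_cast h1.symm
  obtain ⟨x, hx⟩ := exists_norm_le_of_dual_minimum hdual hspan (Nat.succ_pos _)
    (norm_nonneg (gramSchmidt ℝ d (Fin.rev q)))
    (R := ((q : ℝ) + 1) / 2 * ‖gramSchmidt ℝ b q‖) (by positivity)
    (by
      have h1 := hrd.one_le_norm_mul_norm q
      push_cast
      nlinarith [(Nat.cast_nonneg q : (0 : ℝ) ≤ (q : ℕ))]) hmin c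
  refine ⟨-∑ j, x j • b (ι j), ?_, ?_, ?_⟩
  · exact neg_mem (sum_mem fun j _ => zsmul_mem (mem_latticeOf _ _) _)
  · exact neg_mem (sum_mem fun j _ => zsmul_mem (hmemb j) _)
  · refine le_of_eq_of_le ?_ hx
    congr 1
    rw [sub_neg_eq_add, ← Finset.sum_add_distrib]
    exact Finset.sum_congr rfl fun j _ => by rw [add_smul, Int.cast_smul_eq_zsmul, add_comm]

end DualHKZ

/-! ### Bounds on truncations of the error vector. -/

section ErrorVector

open InnerProductSpace Submodule

variable {n : ℕ} {b : Fin n → EuclideanSpace ℝ (Fin n)} {t v : EuclideanSpace ℝ (Fin n)}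
  {e : Fin n → ℝ}

theorem sum_Iio_smul_gramSchmidt_mem (b : Fin n → EuclideanSpace ℝ (Fin n)) (e : Fin n → ℝ)
    (q : Fin n) :
    ∑ j ∈ Finset.Iio q, e j • gramSchmidt ℝ b j ∈ span ℝ (b '' Set.Iio q) := by
  rw [← span_gramSchmidt_Iio ℝ b q]
  exact sum_mem fun j hj => smul_mem _ _ (subset_span ⟨j, Finset.mem_Iio.1 hj, rfl⟩)

/-- The truncation of the error vector of a closest vector is no longer than its differences
with vectors of the corresponding sublattice. -/
theorem IsClosestVector.norm_sum_Iic_le (hv : IsClosestVector (latticeOf b) t v)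
    (he : t - v = ∑ j, e j • gramSchmidt ℝ b j) (q : Fin n)
    {l : EuclideanSpace ℝ (Fin n)} (hl : l ∈ latticeOf b) (hlq : l ∈ span ℝ (b '' Set.Iic q)) :
    ‖∑ j ∈ Finset.Iic q, e j • gramSchmidt ℝ b j‖ ^ 2 ≤
      ‖∑ j ∈ Finset.Iic q, e j • gramSchmidt ℝ b j - l‖ ^ 2 := by
  set T := ∑ j ∈ Finset.Iic q, e j • gramSchmidt ℝ b j with hT
  set U := ∑ j ∈ (Finset.Iic q)ᶜ, e j • gramSchmidt ℝ b j with hU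
  have hsplit : t - v = T + U := by rw [he, hT, hU, Finset.sum_add_sum_compl]
  have horth : ∀ w ∈ span ℝ (b '' Set.Iic q), inner ℝ w U = 0 := by
    intro w hw
    rw [hU, inner_sum]
    refine Finset.sum_eq_zero fun j hj => ?_
    have hqj : q < j := by simpa using hj
    rw [inner_smul_right, inner_gramSchmidt_eq_zero_of_mem_span b j, mul_zero]
    exact span_mono (Set.image_mono fun k (hk : k ≤ q) => lt_of_le_of_lt hk hqj) hw
  have hTmem : T ∈ span ℝ (b '' Set.Iic q) := by
    rw [← span_gramSchmidt_Iic ℝ b q]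
    exact sum_mem fun j hj => smul_mem _ _ (subset_span ⟨j, Finset.mem_Iic.1 hj, rfl⟩)
  -- Compare `v` with `v + l`: the tail `U` is orthogonal to `T` and to `T - l`, so it cancels from
  -- the comparison.
  have h1 := hv.2 (v + l) (add_mem hv.1 hl)
  rw [norm_sub_rev v t, norm_sub_rev (v + l) t, ← sub_sub, hsplit, add_sub_right_comm] at h1
  have h2 := norm_add_sq_eq_norm_sq_add_norm_sq_of_inner_eq_zero _ _ (horth T hTmem)
  have h3 := norm_add_sq_eq_norm_sq_add_norm_sq_of_inner_eq_zero _ _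
    (horth (T - l) (sub_mem hTmem hlq))
  nlinarith [mul_self_le_mul_self (norm_nonneg _) h1]

theorem norm_sq_sum_Iic_smul_gramSchmidt (b : Fin n → EuclideanSpace ℝ (Fin n)) (e : Fin n → ℝ)
    (q : Fin n) :
    ‖∑ j ∈ Finset.Iic q, e j • gramSchmidt ℝ b j‖ ^ 2 =
      ‖∑ j ∈ Finset.Iio q, e j • gramSchmidt ℝ b j‖ ^ 2 +
        e q ^ 2 * ‖gramSchmidt ℝ b q‖ ^ 2 := by
  rw [← Finset.Iio_insert, Finset.sum_insert (by simp), add_comm]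
  exact norm_sq_add_smul_gramSchmidt b q (sum_Iio_smul_gramSchmidt_mem b e q) (e q)

theorem IsDualHKZ.norm_sq_sum_Iic_le (hb : IsDualHKZ b)
    (hv : IsClosestVector (latticeOf b) t v) (he : t - v = ∑ j, e j • gramSchmidt ℝ b j)
    (q : Fin n) :
    ‖∑ j ∈ Finset.Iic q, e j • gramSchmidt ℝ b j‖ ^ 2 ≤
      (((q : ℝ) + 1) / 2) ^ 2 * ‖gramSchmidt ℝ b q‖ ^ 2 := by
  have hT : ∑ j ∈ Finset.Iic q, e j • gramSchmidt ℝ b j ∈ span ℝ (b '' Set.Iic q) := by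
    rw [← span_gramSchmidt_Iic ℝ b q]
    exact sum_mem fun j hj => smul_mem _ _ (subset_span ⟨j, Finset.mem_Iic.1 hj, rfl⟩)
  obtain ⟨l, hl, hlq, h⟩ := hb.exists_norm_sub_le q hT
  refine (hv.norm_sum_Iic_le he q hl hlq).trans ?_
  rw [← mul_pow]
  gcongr

/-- Comparison of the error vector with its translate by an integer multiple of a basis vector,
followed by rounding in the sublattice below. -/
theorem IsDualHKZ.norm_sq_sum_Iic_le_of_covBy (hb : IsDualHKZ b)
    (hv : IsClosestVector (latticeOf b) t v) (he : t - v = ∑ j, e j • gramSchmidt ℝ b j)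
    {p q : Fin n} (hpq : (p : ℕ) + 1 = q) :
    ‖∑ j ∈ Finset.Iic q, e j • gramSchmidt ℝ b j‖ ^ 2 ≤
      (((p : ℝ) + 1) / 2) ^ 2 * ‖gramSchmidt ℝ b p‖ ^ 2 + 1 / 4 * ‖gramSchmidt ℝ b q‖ ^ 2 := by
  have hIio : Set.Iio q = Set.Iic p := by
    ext j; simp only [Set.mem_Iio, Set.mem_Iic, Fin.lt_def, Fin.le_def]; omega
  set S := ∑ j ∈ Finset.Iio q, e j • gramSchmidt ℝ b j with hS
  set k : ℤ := round (e q)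
  -- Subtracting `k • b q` from the truncation leaves this vector of the lower span plus `(e q - k)`
  -- times the Gram–Schmidt vector; the former is then rounded in the lower sublattice.
  have hw : S + k • (gramSchmidt ℝ b q - b q) ∈ span ℝ (b '' Set.Iio q) :=
    add_mem (sum_Iio_smul_gramSchmidt_mem b e q) (zsmul_mem (gramSchmidt_sub_mem_span b q) _)
  obtain ⟨l, hl, hlp, h⟩ := hb.exists_norm_sub_le p (hIio ▸ hw)
  rw [← hIio] at hlp
  have hbq : b q ∈ span ℝ (b '' Set.Iic q) := subset_span ⟨q, Set.self_mem_Iic, rfl⟩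
  have h1 := hv.norm_sum_Iic_le he q
    (add_mem (zsmul_mem (mem_latticeOf b q) k) hl)
    (add_mem (zsmul_mem hbq k) (span_mono (Set.image_mono Set.Iio_subset_Iic_self) hlp))
  have h2 : ∑ j ∈ Finset.Iic q, e j • gramSchmidt ℝ b j - (k • b q + l) =
      (S + k • (gramSchmidt ℝ b q - b q) - l) + (e q - k) • gramSchmidt ℝ b q := by
    rw [← Finset.Iio_insert, Finset.sum_insert (by simp), ← hS, sub_smul, smul_sub,
      Int.cast_smul_eq_zsmul]
    abel
  rw [h2, norm_sq_add_smul_gramSchmidt b q (sub_mem hw hlp)] at h1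
  have h3 : (e q - k) ^ 2 ≤ 1 / 4 := by
    have := abs_le.1 (abs_sub_round (e q))
    nlinarith [this.1, this.2]
  refine h1.trans (add_le_add ?_ (by gcongr))
  rw [← mul_pow]
  gcongr

end ErrorVector

/-! ### Elimination of the Gram–Schmidt norms and conclusion. -/

/-- Since `(m + 1)² - 1 = m (m + 2)`, both `h₁` and `h₃` become the ellipse when `m A = (m + 2) B`.
For larger `A` the bound `h₁` suffices; for smaller `A` it is `h₃`, with `h₂` supplying the sign of
`(m / 2)² - x²`. -/
theorem ellipse_of_bounds {m x y A B : ℝ} (hm : 1 ≤ m) (hA : 0 < A) (hB : 0 < B)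
    (h₁ : x ^ 2 * A + y ^ 2 * B ≤ ((m + 1) / 2) ^ 2 * B)
    (h₂ : x ^ 2 * A ≤ (m / 2) ^ 2 * A)
    (h₃ : x ^ 2 * A + y ^ 2 * B ≤ (m / 2) ^ 2 * A + 1 / 4 * B) :
    x ^ 2 * ((m + 1) ^ 2 / 4 - 1 / 4) + y ^ 2 * (m ^ 2 / 4) ≤ (m + 1) ^ 2 / 4 * (m ^ 2 / 4) := by
  have hx : x ^ 2 ≤ (m / 2) ^ 2 := le_of_mul_le_mul_right h₂ hA
  have hm2 : 0 ≤ m ^ 2 := sq_nonneg m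
  refine le_of_mul_le_mul_right ?_ hB
  rcases le_total (m * A) ((m + 2) * B) with h | h
  · have e1 := mul_le_mul_of_nonneg_left h₃ hm2
    have e2 := mul_le_mul_of_nonneg_left h (mul_nonneg (by linarith : 0 ≤ m) (sub_nonneg.2 hx))
    linarith
  · have e1 := mul_le_mul_of_nonneg_left h₁ hm2
    have e2 := mul_le_mul_of_nonneg_left h (mul_nonneg (by linarith : 0 ≤ m) (sq_nonneg x))
    linarith

/-- Here `e : Fin n → ℝ` is indexed from `0`, so the coefficient `e_i` (for `1 ≤ i ≤ n`) is
`e ⟨i - 1, _⟩`. -/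
theorem mainTheorem4 (n : ℕ) (b : Fin n → EuclideanSpace ℝ (Fin n)) (hb : IsDualHKZ b)
    (t v : EuclideanSpace ℝ (Fin n)) (hv : IsClosestVector (latticeOf b) t v)
    (e : Fin n → ℝ) (he : t - v = ∑ j, e j • InnerProductSpace.gramSchmidt ℝ b j)
    (i : ℕ) (h2 : 2 ≤ i) (hn : i ≤ n) :
    (e ⟨i - 2, by omega⟩ ^ 2 * ((i : ℝ) ^ 2 / 4 - 1 / 4)
        + e ⟨i - 1, by omega⟩ ^ 2 * (((i : ℝ) - 1) ^ 2 / 4)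
      ≤ (i : ℝ) ^ 2 / 4 * (((i : ℝ) - 1) ^ 2 / 4)) ∧
    |e ⟨i - 2, by omega⟩| ≤ ((i : ℝ) - 1) / 2 ∧ |e ⟨i - 1, by omega⟩| ≤ (i : ℝ) / 2 := by
  obtain ⟨m, rfl⟩ : ∃ m, i = m + 2 := ⟨i - 2, by omega⟩
  set p : Fin n := ⟨m + 2 - 2, by omega⟩ with hp
  set q : Fin n := ⟨m + 2 - 1, by omega⟩ with hq
  have hpq : (p : ℕ) + 1 = q := by simp [hp, hq]
  have hpm : ((p : ℕ) : ℝ) = m := by simp [hp]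
  have hqm : ((q : ℕ) : ℝ) = m + 1 := by rw [← hpq]; push_cast; rw [hpm]
  have hpos : ∀ j, 0 < ‖InnerProductSpace.gramSchmidt ℝ b j‖ ^ 2 := fun j =>
    pow_pos (norm_pos_iff.2 (InnerProductSpace.gramSchmidt_ne_zero j hb.1)) 2
  have h₁ := hb.norm_sq_sum_Iic_le hv he q
  have h₂ := hb.norm_sq_sum_Iic_le hv he p
  have h₃ := hb.norm_sq_sum_Iic_le_of_covBy hv he hpq
  have hIio : Finset.Iio q = Finset.Iic p := by
    ext j; simp only [Finset.mem_Iio, Finset.mem_Iic, Fin.lt_def, Fin.le_def]; omega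
  rw [norm_sq_sum_Iic_smul_gramSchmidt, hIio] at h₁ h₃
  have h₄ : e p ^ 2 * ‖InnerProductSpace.gramSchmidt ℝ b p‖ ^ 2 ≤
      ‖∑ j ∈ Finset.Iic p, e j • InnerProductSpace.gramSchmidt ℝ b j‖ ^ 2 := by
    rw [norm_sq_sum_Iic_smul_gramSchmidt]
    exact le_add_of_nonneg_left (sq_nonneg _)
  rw [hqm] at h₁
  rw [hpm] at h₂ h₃
  have hm : (1 : ℝ) ≤ (m : ℝ) + 1 := by linarith [(Nat.cast_nonneg m : (0 : ℝ) ≤ m)]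
  have key := ellipse_of_bounds (x := e p) (y := e q) hm (hpos p) (hpos q)
    (by linarith) (h₄.trans h₂) (by linarith)
  have hi : ((m + 2 : ℕ) : ℝ) = (m : ℝ) + 1 + 1 := by push_cast; ring
  rw [hi, add_sub_cancel_right]
  refine ⟨key, abs_le_of_sq_le_sq ?_ (by linarith), abs_le_of_sq_le_sq ?_ (by linarith)⟩
  · exact le_of_mul_le_mul_right (h₄.trans h₂) (hpos p)
  · refine le_of_mul_le_mul_right (le_trans ?_ h₁) (hpos q)
    exact le_add_of_nonneg_left (sq_nonneg _)
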